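/- Let $\mathcal H$ be a finite-dimensional real Hilbert space and let $f,g\colon\mathcal H\to\,]-\infty,+\infty]$ be proper lower semicontinuous convex functions. Write $\operatorname{dom} f=\{x : f(x)<+\infty\}$, $f^*(u)=\sup_{x\in\mathcal H}(\langle x,u\rangle-f(x))$ and $\operatorname{prox}_f(x)=\operatorname{argmin}_{y\in\mathcal H}\bigl(f(y)+\tfrac12\|y-x\|^2\bigr)$ (likewise for $g$), and for a set $C\subseteq\mathcal H$ let $\overline{C}$ be its closure, $P_C(x)$ the point of $C$ nearest to $x$, $C^{\circ}=\{u : \langle x,u\rangle\le 0 \text{ for all } x\in C\}$ its polar cone and $\operatorname{rec} C=\{x : x+y\in C\text{ for all }y\in C\}$ its recession cone. Let $$T=\tfrac12\operatorname{Id}+\tfrac12(2\operatorname{prox}_g-\operatorname{Id})(2\operatorname{prox}_f-\operatorname{Id})$$ be the Douglas–Rachford operator, let $$v_p=P_{\overline{\operatorname{dom} f-\operatorname{dom} g}}(0),\qquad v_d=P_{\overline{\operatorname{dom} f^*+\operatorname{dom} g^*}}(0),$$ and let $v=P_{\overline{\operatorname{ran}(\operatorname{Id}-T)}}(0)$ be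 the minimal displacement vector of $T$. Then $\operatorname{prox}_f$, $\operatorname{prox}_g$ and the vectors $v_p,v_d,v$ are well defined (the respective minimizers exist and are unique), and 1. $-v_p\in\bigl(\operatorname{rec}(\overline{\operatorname{dom} f})\bigr)^{\circ}\cap\bigl(\operatorname{rec}(-\overline{\operatorname{dom} g})\bigr)^{\circ}$; 2. $-v_d\in\bigl(\operatorname{rec}(\overline{\operatorname{dom} f^*})\bigr)^{\circ}\cap\bigl(\operatorname{rec}(\overline{\operatorname{dom} g^*})\bigr)^{\circ}$; 3. $-v_p\in\operatorname{rec}(\overline{\operatorname{dom} f^*})\cap\operatorname{rec}(-\overline{\operatorname{dom} g^*})$; 4. $-v_d\in\operatorname{rec}(\overline{\operatorname{dom} f})\cap\operatorname{rec}(\overline{\operatorname{dom} g})$; 5. $\langle v_p,v_d\rangle=0$; 6. $v_p+v_d\in\overline{\operatorname{dom} f-\operatorname{dom} g}\,\cap\,\overline{\operatorname{dom} f^*+\operatorname{dom} g^*}$; 7. $v=v_p+v_d$. -/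

import Mathlib

open scoped Pointwise InnerProductSpace

namespace DouglasRachford

noncomputable section

variable {H : Type*} [NormedAddCommGroup H] [InnerProductSpace ℝ H]

/-- A proper lower semicontinuous convex function `f : H → ]-∞, +∞]`.
Convexity of an extended-real-valued function is convexity of its epigraph. -/
structure ProperLscConvex (f : H → EReal) : Prop where
  ne_bot : ∀ x, f x ≠ ⊥
  exists_ne_top : ∃ x, f x ≠ ⊤
  lsc : LowerSemicontinuous f
  convex_epigraph : Convex ℝ {p : H × ℝ | f p.1 ≤ (p.2 : EReal)}

/-- The (effective) domain of `f`. -/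
def dom (f : H → EReal) : Set H := {x | f x < ⊤}

/-- The Fenchel conjugate `f* u = sup_x (⟪x, u⟫ - f x)`. -/
def conj (f : H → EReal) (u : H) : EReal := ⨆ x : H, ((⟪x, u⟫_ℝ : ℝ) : EReal) - f x

/-- `p` minimizes `y ↦ f y + ‖y - x‖ ^ 2 / 2` over `H`. -/
def IsProx (f : H → EReal) (x p : H) : Prop :=
  ∀ y : H, f p + ((‖p - x‖ ^ 2 / 2 : ℝ) : EReal) ≤ f y + ((‖y - x‖ ^ 2 / 2 : ℝ) : EReal)

/-- The proximity operator of `f`: the minimizer of `y ↦ f y + ‖y - x‖ ^ 2 / 2`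
(an arbitrary point if there is no minimizer). -/
def prox (f : H → EReal) (x : H) : H := Classical.epsilon (IsProx f x)

/-- `p` is a point of `C` at minimal distance from `x`. -/
def IsProjection (C : Set H) (x p : H) : Prop := p ∈ C ∧ ∀ y ∈ C, ‖p - x‖ ≤ ‖y - x‖

/-- The projection of `x` onto `C`: the point of `C` nearest to `x`
(an arbitrary point if there is no such point). -/
def proj (C : Set H) (x : H) : H := Classical.epsilon (IsProjection C x)

/-- The polar cone of `C`. -/
def polarCone (C : Set H) : Set H := {u | ∀ x ∈ C, ⟪x, u⟫_ℝ ≤ 0}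

/-- The recession cone of `C`. -/
def recCone (C : Set H) : Set H := {x | ∀ y ∈ C, x + y ∈ C}

/-- The Douglas-Rachford operator `T = (1/2) Id + (1/2) (2 prox_g - Id) (2 prox_f - Id)`. -/
def drOperator (f g : H → EReal) (s : H) : H :=
  (1 / 2 : ℝ) • s + (1 / 2 : ℝ) •
    ((2 : ℝ) • prox g ((2 : ℝ) • prox f s - s) - ((2 : ℝ) • prox f s - s))

/-- The closure of the range of `Id - T`. -/
def displacementSet (T : H → H) : Set H := closure (Set.range fun s => s - T s)

/-- The closure of `dom f - dom g`. -/
def primalSet (f g : H → EReal) : Set H := closure (dom f - dom g)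

/-- The closure of `dom f* + dom g*`. -/
def dualSet (f g : H → EReal) : Set H := closure (dom (conj f) + dom (conj g))

/-- `v`, the minimal displacement vector of `T`. -/
def minDisplacement (T : H → H) : H := proj (displacementSet T) 0

/-- `v_p`, the projection of `0` onto the closure of `dom f - dom g`. -/
def vP (f g : H → EReal) : H := proj (primalSet f g) 0

/-- `v_d`, the projection of `0` onto the closure of `dom f* + dom g*`. -/
def vD (f g : H → EReal) : H := proj (dualSet f g) 0

end

end DouglasRachford

open DouglasRachford

/-!
The proof avoids relative interiors and range theorems for monotone operators: both vectors `v_p`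
and `v_d` are produced at once as asymptotic directions of a regularized fixed-point problem.

For `ε > 0` the equation `s - T s = -ε s` has a solution `s`, because `T` is nonexpansive. Put
`x = prox_f s`, `u = s - x`, `y = prox_g (2 x - s)`, `w = 2 x - s - y`. Then `u` is a subgradient of
`f` at `x`, `w` is a subgradient of `g` at `y`, and `s - T s = x - y = u + w =: r`. As `ε → 0` the
vectors `ε s = -r`, `ε x`, `ε u` stay bounded, so along a subsequence `ε x → X`, `ε u → U` and
`r → R = -(X + U)`. Since `ε (x - y) → 0` and `ε (u + w) → 0`, also `ε y → X` and `ε w → -U`, whence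
`X` is a recession direction of `dom f` and `dom g`, `U` one of `dom f*`, and `-U` one of `dom g*`
(`mem_recCone_of_tendsto`).

By the Fenchel-Young inequality `⟪x - a, u - c⟫` is bounded below for fixed `a ∈ dom f`,
`c ∈ dom f*` (`exists_le_inner_of_subgradient`), and similarly for `g`. Adding the two bounds,
multiplying by `ε` and passing to the limit gives
`⟪X, R - q⟫ + ⟪R - p, U⟫ ≥ 0` for all `p` in the primal set and `q` in the dual set, and `R` lies in
both sets. Hence `⟪-X, q - R⟫ ≥ 0` and `⟪-U, p - R⟫ ≥ 0`. The dual set is invariant under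
translations by `± U`, so `⟪X, U⟫ = 0`. The variational characterization of projections now
identifies `-X` as `v_d`, `-U` as `v_p` and `R = v_p + v_d` as the minimal displacement vector; the
remaining relations are read off.
-/

namespace DouglasRachford

open Filter Topology

variable {H : Type*} [NormedAddCommGroup H] [InnerProductSpace ℝ H]

/-! ### Subgradients and Fenchel duality -/

/-- `u` is a subgradient of `f` at `x` and `f x < ⊤`. The real number `τ` plays the role of `f x`,
and finite upper bounds `t` of `f y` that of `f y`, so that the inequality lives in `ℝ`. -/
def IsSubgradient (f : H → EReal) (x u : H) : Prop :=
  ∃ τ : ℝ, f x ≤ τ ∧ ∀ (y : H) (t : ℝ), f y ≤ t → τ + ⟪y - x, u⟫_ℝ ≤ t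

theorem mem_dom_iff {E : Type*} {f : E → EReal} {x : E} : x ∈ dom f ↔ ∃ t : ℝ, f x ≤ t := by
  constructor
  · intro h
    obtain ⟨t, h1, -⟩ := EReal.lt_iff_exists_real_btwn.1 (show f x < ⊤ from h)
    exact ⟨t, h1.le⟩
  · rintro ⟨t, ht⟩
    exact lt_of_le_of_lt ht (EReal.coe_lt_top t)

theorem mem_dom_conj_iff {f : H → EReal} (hf : ProperLscConvex f) {u : H} :
    u ∈ dom (conj f) ↔ ∃ M : ℝ, ∀ (x : H) (t : ℝ), f x ≤ t → ⟪x, u⟫_ℝ - M ≤ t := by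
  rw [mem_dom_iff]
  refine exists_congr fun M => ?_
  rw [conj, iSup_le_iff]
  constructor
  · intro h x t ht
    have h1 := h x
    have hx : f x ≠ ⊤ := (lt_of_le_of_lt ht (EReal.coe_lt_top t)).ne
    lift f x to ℝ using ⟨hx, hf.ne_bot x⟩ with z
    norm_cast at h1 ht
    linarith
  · intro h x
    by_cases hx : f x = ⊤
    · simp [hx]
    have h1 := h x (f x).toReal (EReal.le_coe_toReal hx)
    lift f x to ℝ using ⟨hx, hf.ne_bot x⟩ with z
    rw [EReal.toReal_coe] at h1
    norm_cast
    linarith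

namespace IsSubgradient

variable {f : H → EReal} {x y u w : H}

theorem mem_dom (h : IsSubgradient f x u) : x ∈ dom f :=
  let ⟨τ, h1, _⟩ := h
  mem_dom_iff.2 ⟨τ, h1⟩

theorem mem_dom_conj (hf : ProperLscConvex f) (h : IsSubgradient f x u) :
    u ∈ dom (conj f) := by
  obtain ⟨τ, -, h2⟩ := h
  refine (mem_dom_conj_iff hf).2 ⟨⟪x, u⟫_ℝ - τ, fun y t ht => ?_⟩
  have := h2 y t ht
  rw [inner_sub_left] at this
  linarith

theorem monotone (h : IsSubgradient f x u) (h' : IsSubgradient f y w) :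
    0 ≤ ⟪x - y, u - w⟫_ℝ := by
  obtain ⟨τ, h1, h2⟩ := h
  obtain ⟨σ, h1', h2'⟩ := h'
  have a := h2 y σ h1'
  have b := h2' x τ h1
  simp only [inner_sub_left, inner_sub_right] at *
  linarith

end IsSubgradient

/-- The graph of the subdifferential is star-monotone: the monotonicity expression is bounded below
not only against points of the graph, but against any point of `dom f × dom f*`. This is the
Fenchel-Young inequality, used once as an equality and twice as an inequality. -/
theorem exists_le_inner_of_subgradient {f : H → EReal} (hf : ProperLscConvex f) {a c : H}
    (ha : a ∈ dom f) (hc : c ∈ dom (conj f)) :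
    ∃ K : ℝ, ∀ x u, IsSubgradient f x u → K ≤ ⟪x - a, u - c⟫_ℝ := by
  obtain ⟨t, ht⟩ := mem_dom_iff.1 ha
  obtain ⟨M, hM⟩ := (mem_dom_conj_iff hf).1 hc
  refine ⟨⟪a, c⟫_ℝ - M - t, fun x u ⟨τ, h1, h2⟩ => ?_⟩
  have h3 := h2 a t ht
  have h4 := hM x τ h1
  simp only [inner_sub_left, inner_sub_right] at *
  linarith

theorem convex_dom {f : H → EReal} (hf : ProperLscConvex f) : Convex ℝ (dom f) := by
  intro x hx y hy a b ha hb hab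
  obtain ⟨s, hs⟩ := mem_dom_iff.1 hx
  obtain ⟨t, ht⟩ := mem_dom_iff.1 hy
  exact mem_dom_iff.2 ⟨_, hf.convex_epigraph (x := (x, s)) hs (y := (y, t)) ht ha hb hab⟩

theorem convex_dom_conj {f : H → EReal} (hf : ProperLscConvex f) : Convex ℝ (dom (conj f)) := by
  intro x hx y hy a b ha hb hab
  obtain ⟨M, hM⟩ := (mem_dom_conj_iff hf).1 hx
  obtain ⟨N, hN⟩ := (mem_dom_conj_iff hf).1 hy
  refine (mem_dom_conj_iff hf).2 ⟨a * M + b * N, fun z t ht => ?_⟩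
  have h1 := mul_le_mul_of_nonneg_left (hM z t ht) ha
  have h2 := mul_le_mul_of_nonneg_left (hN z t ht) hb
  rw [inner_add_right, real_inner_smul_right, real_inner_smul_right]
  have h3 : a * t + b * t = t := by rw [← add_mul, hab, one_mul]
  linarith

/-! ### The proximity operator -/

/-- Fermat's rule for the proximity operator, tested along the segment from `p` to `y`. -/
theorem add_inner_le_of_minimizes {f : H → EReal} (hf : ProperLscConvex f) {x p : H} {τ : ℝ}
    (hp : f p ≤ τ)
    (hmin : ∀ (y : H) (t : ℝ), f y ≤ t → τ + ‖p - x‖ ^ 2 / 2 ≤ t + ‖y - x‖ ^ 2 / 2)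
    {y : H} {t : ℝ} (hy : f y ≤ t) : τ + ⟪y - p, x - p⟫_ℝ ≤ t := by
  have key : ∀ l : ℝ, 0 < l → l ≤ 1 →
      τ + ⟪y - p, x - p⟫_ℝ ≤ t + l * (‖y - p‖ ^ 2 / 2) := by
    intro l hl hl1
    have h1 := hf.convex_epigraph (x := (p, τ)) hp (y := (y, t)) hy
      (a := 1 - l) (b := l) (by linarith) hl.le (by ring)
    have h2 := hmin ((1 - l) • p + l • y) ((1 - l) * τ + l * t) h1
    have h3 : (1 - l) • p + l • y - x = l • (y - p) - (x - p) := by module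
    rw [h3, norm_sub_rev p x, norm_sub_sq_real (l • (y - p)), norm_smul, real_inner_smul_left,
      mul_pow,
      Real.norm_eq_abs, sq_abs] at h2
    have h4 : l * (τ + ⟪y - p, x - p⟫_ℝ) ≤ l * (t + l * (‖y - p‖ ^ 2 / 2)) := by
      nlinarith
    exact le_of_mul_le_mul_left h4 hl
  have hlim : Tendsto (fun l : ℝ => t + l * (‖y - p‖ ^ 2 / 2)) (𝓝[>] 0) (𝓝 t) := by
    have : Tendsto (fun l : ℝ => t + l * (‖y - p‖ ^ 2 / 2)) (𝓝 0)
        (𝓝 (t + 0 * (‖y - p‖ ^ 2 / 2))) := Continuous.tendsto (by fun_prop) 0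
    rw [zero_mul, add_zero] at this
    exact this.mono_left nhdsWithin_le_nhds
  refine ge_of_tendsto hlim ?_
  filter_upwards [Ioc_mem_nhdsGT (zero_lt_one' ℝ)] with l hl using key l hl.1 hl.2

theorem isProx_iff {f : H → EReal} (hf : ProperLscConvex f) {x p : H} :
    IsProx f x p ↔ IsSubgradient f p (x - p) := by
  constructor
  · intro h
    obtain ⟨z, hz⟩ := hf.exists_ne_top
    have hp : f p ≠ ⊤ := by
      intro hp
      have h1 := h z
      rw [hp, EReal.top_add_coe, top_le_iff] at h1
      lift f z to ℝ using ⟨hz, hf.ne_bot z⟩ with t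
      exact EReal.coe_ne_top _ (by exact_mod_cast h1)
    obtain ⟨τ, hτ⟩ : ∃ τ : ℝ, f p = τ := ⟨_, (EReal.coe_toReal hp (hf.ne_bot p)).symm⟩
    refine ⟨τ, hτ.le, fun y t hy => add_inner_le_of_minimizes hf hτ.le (fun y t hy => ?_) hy⟩
    have h1 := (h y).trans (add_le_add_left hy _)
    rw [hτ] at h1
    exact_mod_cast h1
  · rintro ⟨τ, h1, h2⟩ y
    by_cases hy : f y = ⊤
    · simp [hy]
    have h3 := h2 y (f y).toReal (EReal.le_coe_toReal hy)
    lift f y to ℝ using ⟨hy, hf.ne_bot y⟩ with t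
    rw [EReal.toReal_coe] at h3
    refine (add_le_add_left h1 _).trans ?_
    norm_cast
    have h4 : y - x = (y - p) - (x - p) := by abel
    rw [h4, norm_sub_sq_real (y - p), norm_sub_rev p x]
    nlinarith [sq_nonneg ‖y - p‖]

/-- A proper lower semicontinuous convex function decreases at most linearly: it is bounded below
on a ball by compactness, and convexity propagates the bound along rays. -/
theorem exists_linear_minorant [FiniteDimensional ℝ H] {f : H → EReal} (hf : ProperLscConvex f) :
    ∃ (z : H) (m L : ℝ), 0 ≤ L ∧ ∀ (y : H) (t : ℝ), f y ≤ t → m - L * ‖y - z‖ ≤ t := by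
  obtain ⟨z, hz⟩ := hf.exists_ne_top
  obtain ⟨t₀, ht₀⟩ : ∃ t₀ : ℝ, f z ≤ t₀ := mem_dom_iff.1 (lt_top_iff_ne_top.2 hz)
  have hzz : z ∈ Metric.closedBall z 1 := Metric.mem_closedBall_self zero_le_one
  obtain ⟨q, -, hq⟩ := (hf.lsc.lowerSemicontinuousOn (Metric.closedBall z 1)).exists_isMinOn
    ⟨z, hzz⟩ (isCompact_closedBall z 1)
  obtain ⟨m, -, hm⟩ := EReal.lt_iff_exists_real_btwn.1 (bot_lt_iff_ne_bot.2 (hf.ne_bot q))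
  have hball : ∀ (y : H) (t : ℝ), ‖y - z‖ ≤ 1 → f y ≤ t → m ≤ t := by
    intro y t hy hyt
    have h1 : f q ≤ f y := hq (by rwa [Metric.mem_closedBall, dist_eq_norm])
    exact_mod_cast (hm.le.trans h1).trans hyt
  have hL : 0 ≤ t₀ - m := sub_nonneg.2 (hball z t₀ (by simp) ht₀)
  refine ⟨z, m, t₀ - m, hL, fun y t hy => ?_⟩
  rcases le_or_gt ‖y - z‖ 1 with h | h
  · have := hball y t h hy
    nlinarith [mul_nonneg hL (norm_nonneg (y - z))]
  · set d := ‖y - z‖ with hd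
    have hd0 : 0 < d := by linarith
    have h1 := hf.convex_epigraph (x := (z, t₀)) ht₀ (y := (y, t)) hy
      (a := 1 - d⁻¹) (b := d⁻¹) (sub_nonneg.2 (inv_le_one_of_one_le₀ h.le))
      (inv_nonneg.2 hd0.le) (by ring)
    have h2 : m ≤ (1 - d⁻¹) * t₀ + d⁻¹ * t := by
      refine hball ((1 - d⁻¹) • z + d⁻¹ • y) _ ?_ h1
      have h3 : (1 - d⁻¹) • z + d⁻¹ • y - z = d⁻¹ • (y - z) := by module
      rw [h3, norm_smul, Real.norm_eq_abs, abs_of_pos (inv_pos.2 hd0), ← hd,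
        inv_mul_cancel₀ hd0.ne']
    have h4 : d * m ≤ (d - 1) * t₀ + t := by
      have h5 := mul_le_mul_of_nonneg_left h2 hd0.le
      have h6 : d * ((1 - d⁻¹) * t₀ + d⁻¹ * t) = (d - 1) * t₀ + t := by
        field_simp
      linarith
    nlinarith

theorem exists_isSubgradient_sub [FiniteDimensional ℝ H] {f : H → EReal}
    (hf : ProperLscConvex f) (x : H) : ∃ p, IsSubgradient f p (x - p) := by
  obtain ⟨z, m, L, hL, hmin⟩ := exists_linear_minorant hf
  obtain ⟨y₀, hy₀⟩ := hf.exists_ne_top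
  obtain ⟨t₀, ht₀⟩ : ∃ t₀ : ℝ, f y₀ ≤ t₀ := mem_dom_iff.1 (lt_top_iff_ne_top.2 hy₀)
  -- minimize `φ (y, t) = t + ‖y - x‖ ^ 2 / 2` over the epigraph, where `φ` is coercive
  let φ : H × ℝ → ℝ := fun q => q.2 + ‖q.1 - x‖ ^ 2 / 2
  have hφ : Continuous φ := by fun_prop
  set c := φ (y₀, t₀) with hc
  have hE : IsClosed {q : H × ℝ | f q.1 ≤ (q.2 : EReal)} :=
    hf.lsc.isClosed_epigraph.preimage
      (f := fun q : H × ℝ => (q.1, (q.2 : EReal)))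
      (continuous_fst.prodMk (continuous_coe_real_ereal.comp continuous_snd))
  let S : Set (H × ℝ) := {q | f q.1 ≤ (q.2 : EReal)} ∩ {q | φ q ≤ c}
  have hS : IsCompact S := by
    set k := ‖x - z‖
    set K := c - m + L * k
    set R := 2 * L + 2 + |K|
    refine ((isCompact_closedBall x R).prod
      (isCompact_Icc (a := m - L * (R + k)) (b := c))).of_isClosed_subset
      (hE.inter (isClosed_le hφ continuous_const)) ?_
    rintro ⟨y, t⟩ ⟨h1, h2⟩
    have h1 : f y ≤ t := h1
    have h2 : t + ‖y - x‖ ^ 2 / 2 ≤ c := h2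
    have h3 := hmin y t h1
    have h4 : ‖y - z‖ ≤ ‖y - x‖ + k := by
      simpa using norm_add_le (y - x) (x - z)
    have h5 := mul_le_mul_of_nonneg_left h4 hL
    have h6 : ‖y - x‖ ≤ R := by
      by_contra! hR
      have hK := abs_nonneg K
      have hK' := le_abs_self K
      have h7 : ‖y - x‖ * (‖y - x‖ / 2 - L) ≤ K := by
        simp only [K]
        nlinarith
      have h8 : 1 + |K| / 2 ≤ ‖y - x‖ / 2 - L := by
        simp only [R] at hR
        linarith
      have h9 : 2 ≤ ‖y - x‖ := by
        simp only [R] at hR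
        linarith
      nlinarith
    refine ⟨by rwa [Metric.mem_closedBall, dist_eq_norm], ?_, ?_⟩
    · have := mul_le_mul_of_nonneg_left h6 hL
      -- on the sublevel set the linear minorant bounds `t` from below
      change m - L * (R + k) ≤ t
      linarith
    · change t ≤ c
      linarith [sq_nonneg ‖y - x‖]
  obtain ⟨⟨p, τ⟩, ⟨hp, hpc⟩, hpm⟩ :=
    hS.exists_isMinOn ⟨(y₀, t₀), ht₀, le_refl c⟩ hφ.continuousOn
  refine ⟨p, τ, hp, fun y t hy => add_inner_le_of_minimizes hf hp (fun y t hy => ?_) hy⟩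
  rcases le_or_gt (φ (y, t)) c with h | h
  · exact hpm (show (y, t) ∈ S from ⟨hy, h⟩)
  · exact (show φ (p, τ) ≤ φ (y, t) from le_trans hpc h.le)

theorem existsUnique_isProx [FiniteDimensional ℝ H] {f : H → EReal}
    (hf : ProperLscConvex f) (x : H) : ∃! p, IsProx f x p := by
  obtain ⟨p, hp⟩ := exists_isSubgradient_sub hf x
  refine ⟨p, (isProx_iff hf).2 hp, fun q hq => ?_⟩
  have h := ((isProx_iff hf).1 hq).monotone hp
  have h1 : x - q - (x - p) = -(q - p) := by abel
  rw [h1, inner_neg_right, real_inner_self_eq_norm_sq] at h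
  have h2 : ‖q - p‖ = 0 := pow_eq_zero_iff two_ne_zero |>.1
    (le_antisymm (by linarith) (sq_nonneg _))
  exact sub_eq_zero.1 (norm_eq_zero.1 h2)

theorem isSubgradient_prox [FiniteDimensional ℝ H] {f : H → EReal} (hf : ProperLscConvex f)
    (x : H) : IsSubgradient f (prox f x) (x - prox f x) :=
  (isProx_iff hf).1 (Classical.epsilon_spec (existsUnique_isProx hf x).exists)

theorem prox_firmly_nonexpansive [FiniteDimensional ℝ H] {f : H → EReal}
    (hf : ProperLscConvex f) (x y : H) :
    ‖prox f x - prox f y‖ ^ 2 ≤ ⟪prox f x - prox f y, x - y⟫_ℝ := by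
  have h := (isSubgradient_prox hf x).monotone (isSubgradient_prox hf y)
  have h1 : x - prox f x - (y - prox f y) = (x - y) - (prox f x - prox f y) := by abel
  rw [h1, inner_sub_right, real_inner_self_eq_norm_sq] at h
  linarith

theorem norm_prox_sub_prox_le [FiniteDimensional ℝ H] {f : H → EReal}
    (hf : ProperLscConvex f) (x y : H) : ‖prox f x - prox f y‖ ≤ ‖x - y‖ := by
  have h := (prox_firmly_nonexpansive hf x y).trans (real_inner_le_norm _ _)
  rcases (norm_nonneg (prox f x - prox f y)).eq_or_lt with h0 | h0
  · rw [← h0]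
    exact norm_nonneg _
  · rw [sq] at h
    exact le_of_mul_le_mul_left h h0

theorem norm_reflected_prox_sub_le [FiniteDimensional ℝ H] {f : H → EReal}
    (hf : ProperLscConvex f) (x y : H) :
    ‖((2 : ℝ) • prox f x - x) - ((2 : ℝ) • prox f y - y)‖ ≤ ‖x - y‖ := by
  have h1 : ((2 : ℝ) • prox f x - x) - ((2 : ℝ) • prox f y - y)
      = (2 : ℝ) • (prox f x - prox f y) - (x - y) := by module
  rw [h1]
  refine le_of_sq_le_sq ?_ (norm_nonneg _)
  have := prox_firmly_nonexpansive hf x y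
  rw [norm_sub_sq_real, norm_smul, real_inner_smul_left, mul_pow, Real.norm_eq_abs, sq_abs]
  linarith

/-! ### The Douglas-Rachford operator -/

theorem norm_drOperator_sub_le [FiniteDimensional ℝ H] {f g : H → EReal}
    (hf : ProperLscConvex f) (hg : ProperLscConvex g) (s t : H) :
    ‖drOperator f g s - drOperator f g t‖ ≤ ‖s - t‖ := by
  set a := (2 : ℝ) • prox f s - s with ha
  set b := (2 : ℝ) • prox f t - t with hb
  have h1 : drOperator f g s - drOperator f g t = (1 / 2 : ℝ) • (s - t) +
      (1 / 2 : ℝ) • (((2 : ℝ) • prox g a - a) - ((2 : ℝ) • prox g b - b)) := by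
    rw [drOperator, drOperator, ← ha, ← hb]
    module
  have h2 := norm_reflected_prox_sub_le hg a b
  have h3 : ‖a - b‖ ≤ ‖s - t‖ := norm_reflected_prox_sub_le hf s t
  rw [h1]
  refine (norm_add_le _ _).trans ?_
  rw [norm_smul, norm_smul, Real.norm_eq_abs, abs_of_pos (by norm_num)]
  linarith

/-- The regularized equation `s - T s = -ε s` is the fixed-point equation of the contraction
`(1 + ε)⁻¹ T`. -/
theorem exists_sub_drOperator_eq_neg_smul [FiniteDimensional ℝ H] {f g : H → EReal}
    (hf : ProperLscConvex f) (hg : ProperLscConvex g) {ε : ℝ} (hε : 0 < ε) :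
    ∃ s, s - drOperator f g s = -(ε • s) := by
  have h1 : 0 < 1 + ε := by linarith
  have hc : ContractingWith (Real.toNNReal (1 + ε)⁻¹)
      (fun s => (1 + ε)⁻¹ • drOperator f g s) := by
    refine ⟨?_, LipschitzWith.of_dist_le_mul fun s t => ?_⟩
    · rw [Real.toNNReal_lt_one]
      exact inv_lt_one_of_one_lt₀ (by linarith)
    · rw [Real.coe_toNNReal _ (inv_nonneg.2 h1.le), dist_eq_norm, dist_eq_norm, ← smul_sub,
        norm_smul, Real.norm_eq_abs, abs_of_pos (inv_pos.2 h1)]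
      exact mul_le_mul_of_nonneg_left (norm_drOperator_sub_le hf hg s t) (inv_nonneg.2 h1.le)
  refine ⟨hc.fixedPoint, ?_⟩
  have h2 : (1 + ε)⁻¹ • drOperator f g hc.fixedPoint = hc.fixedPoint := hc.fixedPoint_isFixedPt
  have h3 : drOperator f g hc.fixedPoint = (1 + ε) • hc.fixedPoint := by
    conv_rhs => rw [← h2]
    rw [smul_inv_smul₀ h1.ne']
  rw [h3]
  module

theorem norm_smul_le_of_sub_drOperator_eq [FiniteDimensional ℝ H] {f g : H → EReal}
    (hf : ProperLscConvex f) (hg : ProperLscConvex g) {ε : ℝ} (hε : 0 < ε) {s : H}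
    (hs : s - drOperator f g s = -(ε • s)) : ‖ε • s‖ ≤ ‖drOperator f g 0‖ := by
  have h1 : drOperator f g s = (1 + ε) • s := by
    rw [add_smul, one_smul, ← neg_neg (ε • s), ← hs]
    abel
  have h2 : ‖drOperator f g s‖ ≤ ‖s‖ + ‖drOperator f g 0‖ := by
    have h3 := norm_drOperator_sub_le hf hg s 0
    have h4 := norm_add_le (drOperator f g s - drOperator f g 0) (drOperator f g 0)
    rw [sub_add_cancel] at h4
    rw [sub_zero] at h3
    linarith
  rw [h1, norm_smul, Real.norm_eq_abs, abs_of_pos (by linarith)] at h2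
  rw [norm_smul, Real.norm_eq_abs, abs_of_pos hε]
  linarith

/-! ### Recession directions and projections of the origin -/

/-- Limits of `ε • x` with `x` in a convex set and `ε → 0⁺` are recession directions. -/
theorem mem_recCone_of_tendsto {C : Set H} (hC : Convex ℝ C) {e : ℕ → ℝ} {x : ℕ → H} {X : H}
    (he : Tendsto e atTop (𝓝 0)) (he0 : ∀ n, 0 ≤ e n) (he1 : ∀ n, e n ≤ 1)
    (hx : ∀ n, x n ∈ C) (hX : Tendsto (fun n => e n • x n) atTop (𝓝 X)) :
    X ∈ recCone (closure C) := by
  intro y hy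
  have h : Tendsto (fun n => e n • x n + (1 - e n) • y) atTop (𝓝 (X + (1 - 0 : ℝ) • y)) :=
    hX.add ((tendsto_const_nhds.sub he).smul_const y)
  rw [sub_zero, one_smul] at h
  exact isClosed_closure.mem_of_tendsto h (Eventually.of_forall fun n =>
    hC.closure (subset_closure (hx n)) hy (he0 n) (sub_nonneg.2 (he1 n)) (by ring))

/-- Recession directions of the closure of a summand are recession directions of the closure of
the sum. -/
theorem recCone_closure_subset_add {E : Type*} [NormedAddCommGroup E] (A B : Set E) :
    recCone (closure A) ⊆ recCone (closure (A + B)) := by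
  intro h hh y hy
  have h1 : Set.MapsTo (fun y => h + y) (A + B) (closure (A + B)) := by
    rintro _ ⟨a, ha, b, hb, rfl⟩
    have h2 : h + a ∈ closure A := hh a (subset_closure ha)
    have h3 := map_mem_closure₂ continuous_add h2 (subset_closure hb)
      (fun a ha b hb => Set.add_mem_add ha hb)
    change h + (a + b) ∈ _
    rwa [← add_assoc]
  simpa using h1.closure_left (by fun_prop) isClosed_closure hy

theorem neg_mem_recCone_neg {E : Type*} [NormedAddCommGroup E] {C : Set E} {h : E}
    (hh : h ∈ recCone C) : -h ∈ recCone (-C) := by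
  intro y hy
  have := hh (-y) hy
  rw [Set.mem_neg]
  rwa [neg_add, neg_neg]

theorem norm_sq_add_norm_sub_sq_le {p q : H} (h : 0 ≤ ⟪p, q - p⟫_ℝ) :
    ‖p‖ ^ 2 + ‖q - p‖ ^ 2 ≤ ‖q‖ ^ 2 := by
  have := norm_add_sq_real p (q - p)
  rw [add_sub_cancel] at this
  linarith

theorem isProjection_of_inner_sub_nonneg {C : Set H} {p : H} (hp : p ∈ C)
    (h : ∀ q ∈ C, 0 ≤ ⟪p, q - p⟫_ℝ) : IsProjection C 0 p := by
  refine ⟨hp, fun q hq => ?_⟩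
  rw [sub_zero, sub_zero]
  refine le_of_sq_le_sq ?_ (norm_nonneg _)
  linarith [norm_sq_add_norm_sub_sq_le (h q hq), sq_nonneg ‖q - p‖]

/-- The variational inequality identifies the unique projection of the origin; convexity of `C` is
not needed for this direction. -/
theorem existsUnique_isProjection {C : Set H} {p : H} (hp : p ∈ C)
    (h : ∀ q ∈ C, 0 ≤ ⟪p, q - p⟫_ℝ) : ∃! p, IsProjection C 0 p := by
  refine ⟨p, isProjection_of_inner_sub_nonneg hp h, fun q ⟨hq, hq'⟩ => ?_⟩
  have h1 := hq' p hp
  rw [sub_zero, sub_zero] at h1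
  have h2 := norm_sq_add_norm_sub_sq_le (h q hq)
  have h3 := pow_le_pow_left₀ (norm_nonneg q) h1 2
  have h4 : ‖q - p‖ = 0 := pow_eq_zero_iff two_ne_zero |>.1
    (le_antisymm (by linarith) (sq_nonneg _))
  exact sub_eq_zero.1 (norm_eq_zero.1 h4)

theorem proj_eq {C : Set H} {p : H} (hp : p ∈ C) (h : ∀ q ∈ C, 0 ≤ ⟪p, q - p⟫_ℝ) :
    proj C 0 = p := by
  have hu := existsUnique_isProjection hp h
  exact hu.unique (Classical.epsilon_spec hu.exists) (isProjection_of_inner_sub_nonneg hp h)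

theorem neg_mem_polarCone_recCone {C : Set H} {p : H} (hp : p ∈ C)
    (h : ∀ q ∈ C, 0 ≤ ⟪p, q - p⟫_ℝ) : -p ∈ polarCone (recCone C) := by
  intro x hx
  have := h (x + p) (hx p hp)
  rw [add_sub_cancel_right] at this
  rw [inner_neg_right, real_inner_comm]
  linarith

theorem polarCone_anti {C D : Set H} (h : C ⊆ D) : polarCone D ⊆ polarCone C :=
  fun _ hu x hx => hu x (h hx)

/-! ### Asymptotic directions of the regularized problem -/

/-- The limit points described in the introduction: `X` and `U` are the limits of `ε x` and `ε u`,
and `-(X + U)` is the limit of the displacements `s - T s`. -/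
theorem exists_asymptotic_directions [FiniteDimensional ℝ H] {f g : H → EReal}
    (hf : ProperLscConvex f) (hg : ProperLscConvex g) :
    ∃ X U : H, X ∈ recCone (closure (dom f)) ∧ X ∈ recCone (closure (dom g)) ∧
      U ∈ recCone (closure (dom (conj f))) ∧ -U ∈ recCone (closure (dom (conj g))) ∧
      -(X + U) ∈ displacementSet (drOperator f g) ∧
      ∀ a ∈ dom f, ∀ b ∈ dom g, ∀ c ∈ dom (conj f), ∀ d ∈ dom (conj g),
        0 ≤ ⟪X, -(X + U) - (c + d)⟫_ℝ + ⟪-(X + U) - (a - b), U⟫_ℝ := by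
  let e : ℕ → ℝ := fun n => 1 / ((n : ℝ) + 1)
  have he : Tendsto e atTop (𝓝 0) := tendsto_one_div_add_atTop_nhds_zero_nat
  have he0 : ∀ n, 0 < e n := fun n => Nat.one_div_pos_of_nat
  have he1 : ∀ n, e n ≤ 1 := fun n =>
    (div_le_one (by positivity)).2 (by linarith [n.cast_nonneg (α := ℝ)])
  choose s hs using fun n => exists_sub_drOperator_eq_neg_smul hf hg (he0 n)
  have hbs : ∀ n, ‖e n • s n‖ ≤ ‖drOperator f g 0‖ := fun n =>
    norm_smul_le_of_sub_drOperator_eq hf hg (he0 n) (hs n)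
  have hbx : ∀ n, ‖e n • prox f (s n)‖ ≤ ‖drOperator f g 0‖ + ‖prox f 0‖ := by
    intro n
    have h1 := norm_prox_sub_prox_le hf (s n) 0
    have h2 := norm_add_le (prox f (s n) - prox f 0) (prox f 0)
    have h3 := hbs n
    rw [sub_add_cancel] at h2
    rw [sub_zero] at h1
    rw [norm_smul, Real.norm_eq_abs, abs_of_pos (he0 n)] at h3 ⊢
    have h4 := mul_le_mul_of_nonneg_left (h2.trans (add_le_add_left h1 _)) (he0 n).le
    have h5 := mul_le_mul_of_nonneg_right (he1 n) (norm_nonneg (prox f 0))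
    linarith
  obtain ⟨⟨Z, X⟩, -, φ, hφ, hlim⟩ := tendsto_subseq_of_bounded
    ((Metric.isBounded_closedBall (x := (0 : H)) (r := ‖drOperator f g 0‖)).prod
      (Metric.isBounded_closedBall (x := (0 : H)) (r := ‖drOperator f g 0‖ + ‖prox f 0‖)))
    (x := fun n => (e n • s n, e n • prox f (s n)))
    (fun n => ⟨by simpa using hbs n, by simpa using hbx n⟩)
  -- the subsequence, with `r` the displacement and `x, u, y, w` the four resolvent components
  set ε : ℕ → ℝ := fun n => e (φ n)
  set x : ℕ → H := fun n => prox f (s (φ n))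
  set u : ℕ → H := fun n => s (φ n) - x n with hu
  set y : ℕ → H := fun n => prox g ((2 : ℝ) • x n - s (φ n))
  set w : ℕ → H := fun n => (2 : ℝ) • x n - s (φ n) - y n with hw
  set r : ℕ → H := fun n => -(ε n • s (φ n)) with hr
  have hε : Tendsto ε atTop (𝓝 0) := he.comp hφ.tendsto_atTop
  have hε0 : ∀ n, 0 ≤ ε n := fun n => (he0 _).le
  have hε1 : ∀ n, ε n ≤ 1 := fun n => he1 _
  have hxu : ∀ n, IsSubgradient f (x n) (u n) := fun n => isSubgradient_prox hf _
  have hyw : ∀ n, IsSubgradient g (y n) (w n) := fun n => isSubgradient_prox hg _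
  have hrT : ∀ n, s (φ n) - drOperator f g (s (φ n)) = r n := fun n => hs (φ n)
  have hrxy : ∀ n, r n = x n - y n := by
    intro n
    rw [← hrT n]
    change s (φ n) - ((1 / 2 : ℝ) • s (φ n) + (1 / 2 : ℝ) •
      ((2 : ℝ) • y n - ((2 : ℝ) • x n - s (φ n)))) = _
    module
  have hruw : ∀ n, r n = u n + w n := by
    intro n
    rw [hrxy n, hu, hw]
    module
  have hX : Tendsto (fun n => ε n • x n) atTop (𝓝 X) := (Prod.tendsto_iff _ _).1 hlim |>.2
  have hZ : Tendsto (fun n => ε n • s (φ n)) atTop (𝓝 Z) := (Prod.tendsto_iff _ _).1 hlim |>.1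
  have hU : Tendsto (fun n => ε n • u n) atTop (𝓝 (Z - X)) := by
    simpa only [hu, smul_sub] using hZ.sub hX
  have hR : Tendsto r atTop (𝓝 (-(X + (Z - X)))) := by
    rw [add_sub_cancel]
    exact hZ.neg
  have hεr : Tendsto (fun n => ε n • r n) atTop (𝓝 0) := by
    simpa using hε.smul hR
  have hY : Tendsto (fun n => ε n • y n) atTop (𝓝 X) := by
    have h := hX.sub hεr
    rw [sub_zero] at h
    refine h.congr fun n => ?_
    rw [hrxy n]
    module
  have hW : Tendsto (fun n => ε n • w n) atTop (𝓝 (-(Z - X))) := by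
    have h := hεr.sub hU
    rw [zero_sub] at h
    refine h.congr fun n => ?_
    rw [hruw n]
    module
  refine ⟨X, Z - X,
    mem_recCone_of_tendsto (convex_dom hf) hε hε0 hε1 (fun n => (hxu n).mem_dom) hX,
    mem_recCone_of_tendsto (convex_dom hg) hε hε0 hε1 (fun n => (hyw n).mem_dom) hY,
    mem_recCone_of_tendsto (convex_dom_conj hf) hε hε0 hε1
      (fun n => (hxu n).mem_dom_conj hf) hU,
    mem_recCone_of_tendsto (convex_dom_conj hg) hε hε0 hε1
      (fun n => (hyw n).mem_dom_conj hg) hW,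
    mem_closure_of_tendsto hR (Eventually.of_forall fun n => ⟨s (φ n), hrT n⟩),
    fun a ha b hb c hc d hd => ?_⟩
  generalize Z - X = U at *
  obtain ⟨K, hK⟩ := exists_le_inner_of_subgradient hf ha hc
  obtain ⟨L, hL⟩ := exists_le_inner_of_subgradient hg hb hd
  -- the sum of the two bounds, with `y, w` eliminated in favour of `r`
  have hsum : ∀ n, K + L ≤ ⟪x n - a, r n - (c + d)⟫_ℝ + ⟪r n - (a - b), u n - c⟫_ℝ
      - ⟪r n - (a - b), r n - (c + d)⟫_ℝ := by
    intro n
    have h1 := hK _ _ (hxu n)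
    have h2 := hL _ _ (hyw n)
    have h3 : y n - b = (x n - a) - (r n - (a - b)) := by
      rw [hrxy n]
      abel
    have h4 : w n - d = (r n - (c + d)) - (u n - c) := by
      rw [hruw n]
      abel
    rw [h3, h4] at h2
    generalize x n - a = A at *
    generalize u n - c = B at *
    generalize r n - (a - b) = P at *
    generalize r n - (c + d) = Q at *
    simp only [inner_sub_left, inner_sub_right] at h2
    linarith
  have hscaled : ∀ n, ε n * (K + L) ≤ ⟪ε n • x n - ε n • a, r n - (c + d)⟫_ℝ
      + ⟪r n - (a - b), ε n • u n - ε n • c⟫_ℝ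
      - ε n * ⟪r n - (a - b), r n - (c + d)⟫_ℝ := by
    intro n
    have h := mul_le_mul_of_nonneg_left (hsum n) (hε0 n)
    rw [← smul_sub, ← smul_sub, real_inner_smul_left, real_inner_smul_right]
    linarith
  have hl : Tendsto (fun n => ε n * (K + L)) atTop (𝓝 0) := by
    simpa using hε.mul_const (K + L)
  have hQ := hR.sub_const (c + d)
  have hP := hR.sub_const (a - b)
  have hrhs := (((hX.sub (hε.smul_const a)).inner hQ (𝕜 := ℝ)).add
    (hP.inner (hU.sub (hε.smul_const c)) (𝕜 := ℝ))).sub (hε.mul (hP.inner hQ (𝕜 := ℝ)))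
  rw [zero_smul, zero_smul, zero_mul, sub_zero, sub_zero, sub_zero] at hrhs
  exact le_of_tendsto_of_tendsto' hl hrhs hscaled

theorem displacementSet_subset [FiniteDimensional ℝ H] {f g : H → EReal}
    (hf : ProperLscConvex f) (hg : ProperLscConvex g) :
    displacementSet (drOperator f g) ⊆ primalSet f g ∩ dualSet f g := by
  refine closure_minimal ?_ (isClosed_closure.inter isClosed_closure)
  rintro _ ⟨s, rfl⟩
  have h1 := isSubgradient_prox hf s
  have h2 := isSubgradient_prox hg ((2 : ℝ) • prox f s - s)
  refine ⟨subset_closure ⟨_, h1.mem_dom, _, h2.mem_dom, ?_⟩,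
    subset_closure ⟨_, h1.mem_dom_conj hf, _, h2.mem_dom_conj hg, ?_⟩⟩
  · simp only [drOperator]
    module
  · simp only [drOperator]
    module

end DouglasRachford

open DouglasRachford
/-- The first five clauses say that the proximity operators and the three projections of `0` are
well defined; the others are the asserted relations. -/
theorem mainTheorem1 {H : Type*} [NormedAddCommGroup H] [InnerProductSpace ℝ H]
    [FiniteDimensional ℝ H] (f g : H → EReal)
    (hf : ProperLscConvex f) (hg : ProperLscConvex g) :
    (∀ x, ∃! p, IsProx f x p) ∧
    (∀ x, ∃! p, IsProx g x p) ∧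
    (∃! p, IsProjection (primalSet f g) 0 p) ∧
    (∃! p, IsProjection (dualSet f g) 0 p) ∧
    (∃! p, IsProjection (displacementSet (drOperator f g)) 0 p) ∧
    -vP f g ∈ polarCone (recCone (closure (dom f))) ∩ polarCone (recCone (-closure (dom g))) ∧
    -vD f g ∈ polarCone (recCone (closure (dom (conj f)))) ∩
      polarCone (recCone (closure (dom (conj g)))) ∧
    -vP f g ∈ recCone (closure (dom (conj f))) ∩ recCone (-closure (dom (conj g))) ∧
    -vD f g ∈ recCone (closure (dom f)) ∩ recCone (closure (dom g)) ∧
    ⟪vP f g, vD f g⟫_ℝ = 0 ∧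
    vP f g + vD f g ∈ primalSet f g ∩ dualSet f g ∧
    minDisplacement (drOperator f g) = vP f g + vD f g := by
  obtain ⟨X, U, hXf, hXg, hUf, hUg, hR, hineq⟩ := exists_asymptotic_directions hf hg
  set R := -(X + U) with hRdef
  have hsub := displacementSet_subset hf hg
  obtain ⟨hRP, hRD⟩ := hsub hR
  have hfP : recCone (closure (dom f)) ⊆ recCone (primalSet f g) := by
    rw [primalSet, sub_eq_add_neg]
    exact recCone_closure_subset_add _ _
  have hgP : recCone (-closure (dom g)) ⊆ recCone (primalSet f g) := by
    rw [primalSet, sub_eq_add_neg, add_comm, neg_closure]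
    exact recCone_closure_subset_add _ _
  have hfD : recCone (closure (dom (conj f))) ⊆ recCone (dualSet f g) :=
    recCone_closure_subset_add _ _
  have hgD : recCone (closure (dom (conj g))) ⊆ recCone (dualSet f g) := by
    rw [dualSet, add_comm]
    exact recCone_closure_subset_add _ _
  have hineq' : ∀ p ∈ primalSet f g, ∀ q ∈ dualSet f g, 0 ≤ ⟪X, R - q⟫_ℝ + ⟪R - p, U⟫_ℝ := by
    intro p hp q hq
    have hmem : (p, q) ∈ closure ((dom f - dom g) ×ˢ (dom (conj f) + dom (conj g))) := by
      rw [closure_prod_eq]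
      exact ⟨hp, hq⟩
    have hcl : IsClosed {z : H × H | 0 ≤ ⟪X, R - z.2⟫_ℝ + ⟪R - z.1, U⟫_ℝ} :=
      isClosed_le continuous_const (by fun_prop)
    refine closure_minimal ?_ hcl hmem
    rintro ⟨_, _⟩ ⟨⟨a, ha, b, hb, rfl⟩, ⟨c, hc, d, hd, rfl⟩⟩
    exact hineq a ha b hb c hc d hd
  have hD : ∀ q ∈ dualSet f g, 0 ≤ ⟪-X, q - R⟫_ℝ := by
    intro q hq
    have h := hineq' R hRP q hq
    rwa [sub_self, inner_zero_left, add_zero, ← neg_sub, inner_neg_right, ← inner_neg_left] at h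
  have hP : ∀ p ∈ primalSet f g, 0 ≤ ⟪-U, p - R⟫_ℝ := by
    intro p hp
    have h := hineq' p hp R hRD
    rwa [sub_self, inner_zero_right, zero_add, real_inner_comm, ← neg_sub, inner_neg_right,
      ← inner_neg_left] at h
  -- the dual set is invariant under translations by both `U` and `-U`
  have hXU : ⟪X, U⟫_ℝ = 0 := by
    have h1 := hD _ (hfD hUf R hRD)
    have h2 := hD _ (hgD hUg R hRD)
    rw [add_sub_cancel_right, inner_neg_left] at h1 h2
    rw [inner_neg_right] at h2
    linarith
  have hXD : -X ∈ dualSet f g := by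
    have h := hfD hUf R hRD
    rwa [hRdef, show U + -(X + U) = -X by abel] at h
  have hUP : -U ∈ primalSet f g := by
    have h := hfP hXf R hRP
    rwa [hRdef, show X + -(X + U) = -U by abel] at h
  have hD' : ∀ q ∈ dualSet f g, 0 ≤ ⟪-X, q - -X⟫_ℝ := by
    intro q hq
    have h := hD q hq
    rw [hRdef, show q - -(X + U) = (q - -X) + U by abel, inner_add_right, inner_neg_left X U,
      hXU] at h
    linarith
  have hP' : ∀ p ∈ primalSet f g, 0 ≤ ⟪-U, p - -U⟫_ℝ := by
    intro p hp
    have h := hP p hp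
    rw [hRdef, show p - -(X + U) = (p - -U) + X by abel, inner_add_right, inner_neg_left U X,
      real_inner_comm X U, hXU] at h
    linarith
  have hRR : ∀ q ∈ displacementSet (drOperator f g), 0 ≤ ⟪R, q - R⟫_ℝ := by
    intro q hq
    have h1 := hP q (hsub hq).1
    have h2 := hD q (hsub hq).2
    have h3 : ⟪R, q - R⟫_ℝ = ⟪-X, q - R⟫_ℝ + ⟪-U, q - R⟫_ℝ := by
      rw [← inner_add_left, ← neg_add]
    linarith
  have hvP : vP f g = -U := proj_eq hUP hP'
  have hvD : vD f g = -X := proj_eq hXD hD'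
  have hv : minDisplacement (drOperator f g) = R := proj_eq hR hRR
  have hsum : -U + -X = R := by rw [hRdef]; abel
  have hpolP := neg_mem_polarCone_recCone hUP hP'
  have hpolD := neg_mem_polarCone_recCone hXD hD'
  rw [hvP, hvD, hv, hsum]
  refine ⟨existsUnique_isProx hf, existsUnique_isProx hg, existsUnique_isProjection hUP hP',
    existsUnique_isProjection hXD hD', existsUnique_isProjection hR hRR,
    ⟨polarCone_anti hfP hpolP, polarCone_anti hgP hpolP⟩,
    ⟨polarCone_anti hfD hpolD, polarCone_anti hgD hpolD⟩,
    ⟨?_, neg_mem_recCone_neg hUg⟩, ?_, ?_, ⟨hRP, hRD⟩, rfl⟩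
  · rwa [neg_neg]
  · rw [neg_neg]
    exact ⟨hXf, hXg⟩
  · rw [inner_neg_neg, real_inner_comm, hXU]
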